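/- For $r>1$ let $$f_r(z)=\frac{\operatorname{Log}(1+rz)}{\operatorname{Log}(1+z)},\quad z\in\mathbb C\setminus(-\infty,-1/r],\ z\neq 0,\qquad f_r(0)=r,$$ where $\operatorname{Log}$ is the principal logarithm. A function $f:(0,\infty)\to[0,\infty)$ is called a Stieltjes function if there are $c\ge 0$ and a positive measure $\mu$ on $[0,\infty)$ such that $f(x)=c+\int_0^\infty\frac{d\mu(t)}{x+t}$ for all $x>0$, the integral being convergent. Then, for every $r>1$, (the restriction to $(0,\infty)$ of) $f_r$ is a Stieltjes function, and for all $z\in\mathbb C\setminus(-\infty,-1/r]$ $$f_r(z)=1+\int_{1/r}^\infty\frac{\omega_r(t)}{z+t}\,dt,$$ with an absolutely convergent integral, where the density $\omega_r\ge 0$ on $[1/r,\infty)$ is given by $$\omega_r(t)=\begin{cases}\dfrac{-1}{\log(1-t)}, & 1/r\le t<1,\\[2mm] 0, & t=1,\\[1mm] \dfrac{\log\big((rt-1)/(t-1)\big)}{\log^2(t-1)+\pi^2}, & t>1.\end{cases}$$ On the interval $(-1/r,\infty)$ the function $f_r$ is strictly convex and strictly decreasing, with $f_r(x)\to\infty$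 as $x\to(-1/r)^+$ and $f_r(x)\to 1$ as $x\to\infty$. Moreover, $$\int_{1/r}^\infty\frac{\omega_r(t)}{t}\,dt=r-1.$$ -/

import Mathlib

open MeasureTheory Set Filter Topology

noncomputable section

/-- A Stieltjes function: `f : (0,∞) → [0,∞)` of the form `f x = c + ∫ dμ(t) / (x + t)` with `c ≥ 0`
and `μ` a positive Borel measure on `[0,∞)` for which the integral converges for every `x > 0`.
A measure on `[0,∞)` is given as a measure on `ℝ` that does not charge `(-∞,0)`. -/
def IsStieltjes (f : ℝ → ℝ) : Prop :=
  (∀ x : ℝ, 0 < x → 0 ≤ f x) ∧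
    ∃ c : ℝ, 0 ≤ c ∧ ∃ μ : Measure ℝ, μ (Iio 0) = 0 ∧
      ∀ x : ℝ, 0 < x →
        Integrable (fun t : ℝ => 1 / (x + t)) μ ∧ f x = c + ∫ t, 1 / (x + t) ∂μ

/-- `f_r(x) = log (1 + r x) / log (1 + x)` on the real axis, with the value `r` at `x = 0`. -/
def fReal (r x : ℝ) : ℝ :=
  if x = 0 then r else Real.log (1 + r * x) / Real.log (1 + x)

/-- `f_r(z) = Log (1 + r z) / Log (1 + z)` with the principal logarithm, and the value `r` at the
removable singularity `z = 0`. -/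
def fComplex (r : ℝ) (z : ℂ) : ℂ :=
  if z = 0 then (r : ℂ) else Complex.log (1 + (r : ℂ) * z) / Complex.log (1 + z)

/-- The density `ω_r`, meant on `[1/r, ∞)`. -/
def omegaDensity (r t : ℝ) : ℝ :=
  if t < 1 then -1 / Real.log (1 - t)
  else if t = 1 then 0
  else Real.log ((r * t - 1) / (t - 1)) / (Real.log (t - 1) ^ 2 + Real.pi ^ 2)

end

/-! Since `Log (1 + rz) - Log (1 + z) = ∫₁ʳ z / (1 + sz) ds`, the function `f_r` equals `1 + ∫₁ʳ
g(z) / (1 + sz) ds` with `g(z) = z / Log (1 + z)`, so everything reduces to a formula for `1 / Log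
(1 + z)`. With `ζ = Log (1 + z)`, that formula comes from integrating `1 / (v (1 - e^{ζ-v}))` around
the strip `|Im v| ≤ π`: the residues at `0` and `ζ` are `1 / (1 - e^ζ) = -1/z` and `1/ζ`, and the
horizontal sides combine into a real integral (`integral_stripKernel`), which becomes
`one_div_clog_one_add` under `t = 1 + e^x`.

For fixed `s`, `g(z) / (1 + sz)` splits into its pole at `-1/s`, weighted by `g(-1/s)`, and an
integral over the cut `t > 1` (`partial_fraction_clog`). Integrating in `s`, the poles sweep out
`(1/r, 1)` through `t = 1/s` and give `-1 / log (1 - t)`; on the cut, Fubini and `∫₁ʳ ds / (st - 1)`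
give the logarithmic numerator.

Monotonicity and convexity are inherited from `x ↦ 1 / (x + t)`, because the density is positive off
`t = 1`. The moment identity is the value at `x = 0`, and the two limits are read off the quotient
of logarithms. -/

/-! ### Logarithmic integrals along horizontal lines -/

theorem tendsto_clog_add_sub_log (c : ℂ) :
    Tendsto (fun R : ℝ => Complex.log ((R : ℂ) + c) - (Real.log R : ℂ)) atTop (𝓝 0) := by
  have h1 : Tendsto (fun R : ℝ => 1 + c * ((R⁻¹ : ℝ) : ℂ)) atTop (𝓝 (1 + c * ((0 : ℝ) : ℂ))) :=
    ((Complex.continuous_ofReal.tendsto 0).comp tendsto_inv_atTop_zero).const_mul c |>.const_add 1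
  simp only [Complex.ofReal_zero, mul_zero, add_zero] at h1
  have h2 : Tendsto (fun R : ℝ => Complex.log (1 + c * ((R⁻¹ : ℝ) : ℂ))) atTop (𝓝 0) := by
    have := h1.clog Complex.one_mem_slitPlane
    rwa [Complex.log_one] at this
  refine h2.congr' ?_
  filter_upwards [eventually_gt_atTop 0, h1.eventually_ne one_ne_zero] with R hR hne
  have hR' : (R : ℂ) ≠ 0 := by exact_mod_cast hR.ne'
  have : (R : ℂ) + c = R * (1 + c * ((R⁻¹ : ℝ) : ℂ)) := by
    push_cast; field_simp
  rw [this, Complex.log_ofReal_mul hR hne]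
  ring

theorem integral_inv_ofReal_sub (c : ℂ) (hc : c.im ≠ 0) (a b : ℝ) :
    ∫ x in a..b, ((x : ℂ) - c)⁻¹ = Complex.log (b - c) - Complex.log (a - c) := by
  have hm : ∀ x : ℝ, (x : ℂ) - c ∈ Complex.slitPlane := fun x =>
    Complex.mem_slitPlane_iff.2 (Or.inr (by simpa using hc))
  rw [intervalIntegral.integral_eq_sub_of_hasDerivAt (f := fun x : ℝ => Complex.log (x - c))]
  · intro x _
    have h : HasDerivAt (fun x : ℝ => (x : ℂ) - c) 1 x :=
      (HasDerivAt.ofReal_comp (hasDerivAt_id x)).sub_const c |>.congr_deriv (by simp)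
    simpa using h.clog_real (hm x)
  · refine Continuous.intervalIntegrable ?_ _ _
    exact (Complex.continuous_ofReal.sub continuous_const).inv₀
      fun x => Complex.slitPlane_ne_zero (hm x)

theorem clog_neg_of_im_pos {x : ℂ} (hx : 0 < x.im) :
    Complex.log (-x) = Complex.log x - Real.pi * Complex.I := by
  rw [Complex.log, Complex.log, Complex.arg_neg_eq_arg_sub_pi_of_im_pos hx, norm_neg]
  push_cast; ring

theorem clog_neg_of_im_neg {x : ℂ} (hx : x.im < 0) :
    Complex.log (-x) = Complex.log x + Real.pi * Complex.I := by
  rw [Complex.log, Complex.log, Complex.arg_neg_eq_arg_add_pi_of_im_neg hx, norm_neg]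
  push_cast; ring

/-- The two horizontal sides of a long rectangle around `a` contribute `2πi` in the limit. -/
theorem tendsto_integral_inv_sub_horizontal (a : ℂ) (ha : |a.im| < Real.pi) :
    Tendsto (fun R : ℝ => (∫ x in -R..R, ((x : ℂ) - (a + Real.pi * Complex.I))⁻¹) -
      ∫ x in -R..R, ((x : ℂ) - (a - Real.pi * Complex.I))⁻¹) atTop
      (𝓝 (2 * Real.pi * Complex.I)) := by
  obtain ⟨h1, h2⟩ := abs_lt.1 ha
  have e : ∀ R : ℝ, (∫ x in -R..R, ((x : ℂ) - (a + Real.pi * Complex.I))⁻¹) -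
      ∫ x in -R..R, ((x : ℂ) - (a - Real.pi * Complex.I))⁻¹ =
      (Complex.log (R + -(a + Real.pi * Complex.I)) - Real.log R)
      - (Complex.log (R + (a + Real.pi * Complex.I)) - Real.log R)
      - (Complex.log (R + -(a - Real.pi * Complex.I)) - Real.log R)
      + (Complex.log (R + (a - Real.pi * Complex.I)) - Real.log R)
      + 2 * Real.pi * Complex.I := by
    intro R
    rw [integral_inv_ofReal_sub _ (by simp; linarith), integral_inv_ofReal_sub _ (by simp; linarith)]
    have e1 : ((-R : ℝ) : ℂ) - (a + Real.pi * Complex.I) = -(R + (a + Real.pi * Complex.I)) := by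
      push_cast; ring
    have e2 : ((-R : ℝ) : ℂ) - (a - Real.pi * Complex.I) = -(R + (a - Real.pi * Complex.I)) := by
      push_cast; ring
    -- The two left endpoints lie on opposite sides of the branch cut, so each reflection
    -- contributes `πi`; the remaining logarithms cancel in the limit.
    rw [e1, e2, clog_neg_of_im_pos (by simp; linarith), clog_neg_of_im_neg (by simp; linarith)]
    simp only [sub_eq_add_neg]
    ring
  simp only [e]
  have := ((((tendsto_clog_add_sub_log (-(a + Real.pi * Complex.I))).sub
    (tendsto_clog_add_sub_log (a + Real.pi * Complex.I))).sub
    (tendsto_clog_add_sub_log (-(a - Real.pi * Complex.I)))).add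
    (tendsto_clog_add_sub_log (a - Real.pi * Complex.I))).add_const (2 * Real.pi * Complex.I)
  simpa using this

/-! ### Removing the poles in the strip -/

/-- The zeros of `e^u - 1` are the multiples of `2πi`; only `0` meets this strip, and it is simple.
The width `2π` accommodates `u = ζ - v` with `|Im ζ| < π` and `|Im v| ≤ π`. -/
theorem dslope_exp_ne_zero {u : ℂ} (hu : |u.im| < 2 * Real.pi) : dslope Complex.exp 0 u ≠ 0 := by
  rcases eq_or_ne u 0 with rfl | h
  · simp
  · rw [dslope_of_ne _ h, slope_def_field]
    refine div_ne_zero ?_ (by simpa using h)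
    rw [Complex.exp_zero, sub_ne_zero]
    intro he
    obtain ⟨n, hn⟩ := Complex.exp_eq_one_iff.1 he
    have him : u.im = n * (2 * Real.pi) := by rw [hn]; simp
    rw [him, abs_mul, abs_of_pos Real.two_pi_pos] at hu
    have h1 : |(n : ℝ)| < 1 := by
      by_contra! hh
      nlinarith [Real.two_pi_pos]
    have h2 : n = 0 := by
      have : |n| < 1 := by exact_mod_cast h1
      exact Int.abs_lt_one_iff.1 this
    exact h (by rw [hn, h2]; simp)

theorem differentiable_dslope_exp : Differentiable ℂ (dslope Complex.exp 0) := by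
  rw [← differentiableOn_univ, Complex.differentiableOn_dslope univ_mem]
  exact Complex.differentiable_exp.differentiableOn

/-- `1/(v(1 - e^{ζ-v}))` with its two poles `0` and `ζ` in the strip removed. -/
theorem exists_differentiableOn_strip {ζ : ℂ} (hζ : |ζ.im| < Real.pi) (h0 : ζ ≠ 0) :
    ∃ H : ℂ → ℂ, DifferentiableOn ℂ H {v | |v.im| ≤ Real.pi} ∧
      ∀ v, v ≠ 0 → v ≠ ζ → |v.im| ≤ Real.pi →
        H v = 1 / (v * (1 - Complex.exp (ζ - v))) - (1 / (1 - Complex.exp ζ)) * v⁻¹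
          - ζ⁻¹ * (v - ζ)⁻¹ := by
  set G : ℂ → ℂ := fun v => (dslope Complex.exp 0 (ζ - v))⁻¹ with hG
  set U : Set ℂ := {v | |(ζ - v).im| < 2 * Real.pi} with hU
  have hUo : IsOpen U := by
    have : Continuous fun v : ℂ => |(ζ - v).im| :=
      (Complex.continuous_im.comp (continuous_const.sub continuous_id)).abs
    exact isOpen_lt this continuous_const
  have hsub : {v : ℂ | |v.im| ≤ Real.pi} ⊆ U := by
    intro v hv
    simp only [mem_ofPred_eq, hU, Complex.sub_im] at hv ⊢
    exact (abs_sub _ _).trans_lt (by linarith)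
  have hGd : DifferentiableOn ℂ G U := by
    intro v hv
    refine DifferentiableAt.differentiableWithinAt ?_
    refine DifferentiableAt.inv ?_ (dslope_exp_ne_zero hv)
    exact (differentiable_dslope_exp _).comp v ((differentiableAt_const _).sub differentiableAt_id)
  have m0 : (0 : ℂ) ∈ U := hsub (by simp [Real.pi_pos.le])
  have mζ : ζ ∈ U := hsub hζ.le
  have hGv : ∀ v, v ≠ ζ → |v.im| ≤ Real.pi →
      Complex.exp (ζ - v) - 1 ≠ 0 ∧ G v = (ζ - v) / (Complex.exp (ζ - v) - 1) := by
    intro v hv hi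
    have h1 : ζ - v ≠ 0 := sub_ne_zero.2 hv.symm
    have h2 := dslope_exp_ne_zero (hsub hi)
    simp only [hG]
    rw [dslope_of_ne _ h1, slope_def_field, Complex.exp_zero, sub_zero] at h2 ⊢
    exact ⟨fun h => h2 (by rw [h, zero_div]), by rw [inv_div]⟩
  have G0 := hGv 0 h0.symm (by simp [Real.pi_pos.le])
  rw [sub_zero] at G0
  have Gζ : G ζ = 1 := by simp [hG]
  -- The function is `G v / (v (v - ζ)) = ζ⁻¹ G v (1 / (v - ζ) - 1 / v)`; subtracting `G ζ` and `G
  -- 0` from the two copies of `G v` removes exactly the principal parts.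
  refine ⟨fun v => ζ⁻¹ * (dslope G ζ v - dslope G 0 v), ?_, ?_⟩
  · refine DifferentiableOn.mono ?_ hsub
    exact (((Complex.differentiableOn_dslope (hUo.mem_nhds mζ)).2 hGd).sub
      ((Complex.differentiableOn_dslope (hUo.mem_nhds m0)).2 hGd)).const_mul _
  · intro v hv0 hvζ hi
    obtain ⟨h1, h2⟩ := hGv v hvζ hi
    obtain ⟨h3, h4⟩ := G0
    have h5 : ζ - v ≠ 0 := sub_ne_zero.2 hvζ.symm
    have h5' : v - ζ ≠ 0 := sub_ne_zero.2 hvζ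
    have h6 : 1 - Complex.exp (ζ - v) ≠ 0 := fun h => h1 (by linear_combination -h)
    have h7 : 1 - Complex.exp ζ ≠ 0 := fun h => h3 (by linear_combination -h)
    simp only
    rw [dslope_of_ne _ hvζ, dslope_of_ne _ hv0, slope_def_field, slope_def_field, Gζ, h4, h2,
      sub_zero]
    have e1 : (ζ - v) / (Complex.exp (ζ - v) - 1) = (v - ζ) / (1 - Complex.exp (ζ - v)) := by
      rw [div_eq_div_iff h1 h6]; ring
    have e2 : ζ / (Complex.exp ζ - 1) = -ζ / (1 - Complex.exp ζ) := by
      rw [div_eq_div_iff h3 h7]; ring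
    rw [e1, e2]
    generalize Complex.exp (ζ - v) = E at *
    generalize Complex.exp ζ = E' at *
    field_simp
    ring

theorem half_le_norm_one_sub_exp {u : ℂ} (hu : 1 ≤ |u.re|) : 1 / 2 ≤ ‖1 - Complex.exp u‖ := by
  have h2 : 2 ≤ Real.exp 1 := by have := Real.add_one_le_exp (1 : ℝ); linarith
  rcases le_abs'.1 hu with h | h
  · have h1 : ‖Complex.exp u‖ ≤ 1 / 2 := by
      rw [Complex.norm_exp]
      calc Real.exp u.re ≤ Real.exp (-1) := Real.exp_le_exp.2 h
        _ = (Real.exp 1)⁻¹ := Real.exp_neg 1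
        _ ≤ 2⁻¹ := inv_anti₀ (by norm_num) h2
        _ = 1 / 2 := by norm_num
    have := norm_sub_norm_le (1 : ℂ) (Complex.exp u)
    rw [norm_one] at this
    linarith
  · have h1 : 2 ≤ ‖Complex.exp u‖ := by
      rw [Complex.norm_exp]
      exact h2.trans (Real.exp_le_exp.2 h)
    have := norm_sub_norm_le (Complex.exp u) (1 : ℂ)
    rw [norm_one, norm_sub_rev] at this
    linarith

/-- This decay makes the vertical sides of the rectangle negligible. -/
theorem norm_strip_kernel_le {ζ v c : ℂ} {d : ℝ} (hd : 1 ≤ d) (hv : d + ‖ζ‖ ≤ |v.re|) :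
    ‖1 / (v * (1 - Complex.exp (ζ - v))) - c * v⁻¹ - ζ⁻¹ * (v - ζ)⁻¹‖
      ≤ (2 + ‖c‖ + ‖ζ⁻¹‖) / d := by
  have hd0 : 0 < d := by linarith
  have h1 : d ≤ ‖v‖ := by
    have := Complex.abs_re_le_norm v
    have := norm_nonneg ζ
    linarith
  have hre : d ≤ |(v - ζ).re| := by
    have := Complex.abs_re_le_norm ζ
    have := abs_sub_abs_le_abs_sub v.re ζ.re
    rw [Complex.sub_re]
    linarith
  have h2 : d ≤ ‖v - ζ‖ := hre.trans (Complex.abs_re_le_norm _)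
  have h3 : 1 / 2 ≤ ‖1 - Complex.exp (ζ - v)‖ := by
    refine half_le_norm_one_sub_exp (hd.trans ?_)
    rwa [← neg_sub v ζ, Complex.neg_re, abs_neg]
  have i1 : ‖v‖⁻¹ ≤ d⁻¹ := inv_anti₀ hd0 h1
  have i2 : ‖v - ζ‖⁻¹ ≤ d⁻¹ := inv_anti₀ hd0 h2
  have i3 : ‖1 - Complex.exp (ζ - v)‖⁻¹ ≤ 2 := by
    have := inv_anti₀ (by norm_num) h3
    simpa using this
  have n1 : ‖1 / (v * (1 - Complex.exp (ζ - v)))‖ ≤ d⁻¹ * 2 := by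
    rw [one_div, norm_inv, norm_mul, mul_inv]
    exact mul_le_mul i1 i3 (by positivity) (by positivity)
  have n2 : ‖c * v⁻¹‖ ≤ ‖c‖ * d⁻¹ := by
    rw [norm_mul, norm_inv]; gcongr
  have n3 : ‖ζ⁻¹ * (v - ζ)⁻¹‖ ≤ ‖ζ⁻¹‖ * d⁻¹ := by
    rw [norm_mul, norm_inv (v - ζ)]; gcongr
  calc _ ≤ ‖1 / (v * (1 - Complex.exp (ζ - v)))‖ + ‖c * v⁻¹‖ + ‖ζ⁻¹ * (v - ζ)⁻¹‖ :=
        (norm_sub_le _ _).trans (by gcongr; exact norm_sub_le _ _)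
    _ ≤ d⁻¹ * 2 + ‖c‖ * d⁻¹ + ‖ζ⁻¹‖ * d⁻¹ := by gcongr
    _ = _ := by ring

/-! ### The contour integral -/

/-- Kernel of the integral representation of `1/ζ + 1/(1 - e^ζ)`. -/
noncomputable def stripKernel (ζ : ℂ) (x : ℝ) : ℂ :=
  1 / ((1 + Complex.exp (ζ - x)) * (x ^ 2 + Real.pi ^ 2))

/-- Cauchy's theorem is applied to the pole-free `H`, so the residues reappear through the explicit
integrals of `v⁻¹` and `(v - ζ)⁻¹` along the horizontal sides, each worth `2πi` in the limit. -/
theorem integral_stripKernel {ζ : ℂ} (hζ : |ζ.im| < Real.pi) (h0 : ζ ≠ 0)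
    (hK : Integrable (stripKernel ζ)) :
    ∫ x, stripKernel ζ x = 1 / ζ + 1 / (1 - Complex.exp ζ) := by
  obtain ⟨H, hHd, hH⟩ := exists_differentiableOn_strip hζ h0
  set c : ℂ := 1 / (1 - Complex.exp ζ)
  have hπ := Real.pi_pos
  obtain ⟨hζ1, hζ2⟩ := abs_lt.1 hζ
  set A : ℂ → ℝ → ℂ := fun a x => ((x : ℂ) - (a + Real.pi * Complex.I))⁻¹ with hA
  set B : ℂ → ℝ → ℂ := fun a x => ((x : ℂ) - (a - Real.pi * Complex.I))⁻¹ with hB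
  have cont : ∀ a : ℂ, a.im ≠ 0 → Continuous fun x : ℝ => ((x : ℂ) - a)⁻¹ := by
    intro a ha
    refine (Complex.continuous_ofReal.sub continuous_const).inv₀ fun x hx => ha ?_
    rw [← sub_eq_zero.1 (show (x : ℂ) - a = 0 from hx)]; simp
  have cA : ∀ a : ℂ, |a.im| < Real.pi → Continuous (A a) := by
    intro a ha
    have := abs_lt.1 ha
    exact cont _ (by simp; linarith)
  have cB : ∀ a : ℂ, |a.im| < Real.pi → Continuous (B a) := by
    intro a ha
    have := abs_lt.1 ha
    exact cont _ (by simp; linarith)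
  have hz0 : |(0 : ℂ).im| < Real.pi := by simpa using hπ
  have cH : ∀ y : ℝ, |y| ≤ Real.pi → Continuous fun x : ℝ => H (x + y * Complex.I) := by
    intro y hy
    have hcomp : ContinuousOn H {v | |v.im| ≤ Real.pi} := hHd.continuousOn
    refine hcomp.comp_continuous (by fun_prop) fun x => ?_
    simpa using hy
  have hlow : |-Real.pi| ≤ Real.pi := by rw [abs_neg, abs_of_pos hπ]
  have hup : |Real.pi| ≤ Real.pi := by rw [abs_of_pos hπ]
  -- On both sides `e^{ζ-v} = -e^{ζ-x}`, so only the factor `1/v` differs, and `1/(x - πi) - 1/(x +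
  -- πi) = 2πi / (x² + π²)`.
  have pt : ∀ x : ℝ, H (x + ((-Real.pi : ℝ) : ℂ) * Complex.I) - H (x + (Real.pi : ℂ) * Complex.I) =
      2 * Real.pi * Complex.I * stripKernel ζ x - c * (A 0 x - B 0 x)
        - ζ⁻¹ * (A ζ x - B ζ x) := by
    intro x
    have im1 : ((x : ℂ) + ((-Real.pi : ℝ) : ℂ) * Complex.I).im = -Real.pi := by simp
    have im2 : ((x : ℂ) + (Real.pi : ℂ) * Complex.I).im = Real.pi := by simp
    have n1 : (x : ℂ) - Real.pi * Complex.I ≠ 0 := by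
      intro h
      have := congrArg Complex.im h
      simp at this
    have n2 : (x : ℂ) + Real.pi * Complex.I ≠ 0 := by
      intro h
      have := congrArg Complex.im h
      simp at this
    rw [hH _ (fun h => by rw [h] at im1; simp at im1) (fun h => by rw [h] at im1; linarith)
        (by rw [im1]; exact hlow),
      hH _ n2 (fun h => by rw [h] at im2; linarith)
        (by rw [im2]; exact hup)]
    have e1 : Complex.exp (ζ - (x + ((-Real.pi : ℝ) : ℂ) * Complex.I)) = -Complex.exp (ζ - x) := by
      rw [show ζ - (x + ((-Real.pi : ℝ) : ℂ) * Complex.I) = (ζ - x) + Real.pi * Complex.I by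
        push_cast; ring, Complex.exp_add, Complex.exp_pi_mul_I]
      ring
    have e2 : Complex.exp (ζ - (x + (Real.pi : ℂ) * Complex.I)) = -Complex.exp (ζ - x) := by
      rw [show ζ - (x + (Real.pi : ℂ) * Complex.I) = (ζ - x) - Real.pi * Complex.I by ring,
        Complex.exp_sub (ζ - x), Complex.exp_pi_mul_I, div_neg, div_one]
    rw [e1, e2]
    simp only [hA, hB, stripKernel]
    have f1 : (x : ℂ) + ((-Real.pi : ℝ) : ℂ) * Complex.I = x - Real.pi * Complex.I := by
      push_cast; ring
    have f2 : (x : ℂ) ^ 2 + (Real.pi : ℂ) ^ 2 =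
        (x - Real.pi * Complex.I) * (x + Real.pi * Complex.I) := by
      linear_combination (Real.pi : ℂ) ^ 2 * Complex.I_sq
    rw [f1, f2, sub_neg_eq_add]
    have key : 1 / ((x - Real.pi * Complex.I) * (1 + Complex.exp (ζ - x))) -
        1 / ((x + Real.pi * Complex.I) * (1 + Complex.exp (ζ - x))) =
        2 * Real.pi * Complex.I * (1 / ((1 + Complex.exp (ζ - x)) *
          ((x - Real.pi * Complex.I) * (x + Real.pi * Complex.I)))) := by
      simp only [one_div, mul_inv]
      have : (x - Real.pi * Complex.I : ℂ)⁻¹ - (x + Real.pi * Complex.I : ℂ)⁻¹ =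
          2 * Real.pi * Complex.I * ((x - Real.pi * Complex.I : ℂ)⁻¹ *
            (x + Real.pi * Complex.I : ℂ)⁻¹) := by
        field_simp; ring
      linear_combination (1 + Complex.exp (ζ - x))⁻¹ * this
    rw [show (x : ℂ) - Real.pi * Complex.I - ζ = x - (ζ + Real.pi * Complex.I) by ring,
      show (x : ℂ) + Real.pi * Complex.I - ζ = x - (ζ - Real.pi * Complex.I) by ring,
      show (x : ℂ) - (0 + Real.pi * Complex.I) = x - Real.pi * Complex.I by ring,
      show (x : ℂ) - (0 - Real.pi * Complex.I) = x + Real.pi * Complex.I by ring]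
    linear_combination key
  -- The sign `σ = ±1` treats the right and left sides at once.
  have side : ∀ σ : ℝ, |σ| = 1 → Tendsto (fun R : ℝ => ∫ y in -Real.pi..Real.pi,
      H (((σ * R : ℝ) : ℂ) + y * Complex.I)) atTop (𝓝 0) := by
    intro σ hσ
    have lim : Tendsto (fun R : ℝ => (2 + ‖c‖ + ‖ζ⁻¹‖) / (R - ‖ζ‖) * |Real.pi - -Real.pi|)
        atTop (𝓝 0) := by
      have : Tendsto (fun R : ℝ => (2 + ‖c‖ + ‖ζ⁻¹‖) / (R - ‖ζ‖)) atTop (𝓝 0) :=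
        Tendsto.const_div_atTop (tendsto_atTop_add_const_right _ _ tendsto_id) _
      simpa using this.mul_const |Real.pi - -Real.pi|
    refine squeeze_zero_norm' ?_ lim
    filter_upwards [eventually_ge_atTop (1 + ‖ζ‖)] with R hR
    refine intervalIntegral.norm_integral_le_of_norm_le_const fun y hy => ?_
    rw [uIoc_of_le (by linarith)] at hy
    have hre : |(((σ * R : ℝ) : ℂ) + y * Complex.I).re| = R := by
      have hR0 : 0 ≤ R := by have := norm_nonneg ζ; linarith
      simp [abs_mul, hσ, abs_of_nonneg hR0]
    have hzR : ‖ζ‖ < R := by linarith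
    rw [hH]
    · exact norm_strip_kernel_le (by linarith) (by rw [hre]; linarith)
    · intro h
      rw [h] at hre
      simp only [Complex.zero_re, abs_zero] at hre
      have := norm_nonneg ζ
      linarith
    · intro h
      rw [h] at hre
      have := Complex.abs_re_le_norm ζ
      linarith
    · have : (((σ * R : ℝ) : ℂ) + y * Complex.I).im = y := by simp
      rw [this]
      exact abs_le.2 ⟨hy.1.le, hy.2⟩
  have rect : ∀ R : ℝ, 2 * Real.pi * Complex.I * (∫ x in -R..R, stripKernel ζ x) =
      c * ((∫ x in -R..R, A 0 x) - ∫ x in -R..R, B 0 x)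
      + ζ⁻¹ * ((∫ x in -R..R, A ζ x) - ∫ x in -R..R, B ζ x)
      - Complex.I * (∫ y in -Real.pi..Real.pi, H (((1 * R : ℝ) : ℂ) + y * Complex.I))
      + Complex.I * (∫ y in -Real.pi..Real.pi, H (((-1 * R : ℝ) : ℂ) + y * Complex.I)) := by
    intro R
    have h := Complex.integral_boundary_rect_eq_zero_of_differentiableOn H ⟨-R, -Real.pi⟩
      ⟨R, Real.pi⟩ (hHd.mono fun v hv => by
        have := (Complex.mem_reProdIm.1 hv).2
        simp only [uIcc_of_le (show -Real.pi ≤ Real.pi by linarith)] at this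
        exact abs_le.2 this)
    simp only [smul_eq_mul] at h
    rw [← intervalIntegral.integral_sub ((cH _ hlow).intervalIntegrable _ _)
      ((cH _ hup).intervalIntegrable _ _)] at h
    simp only [pt] at h
    have iK : IntervalIntegrable (stripKernel ζ) volume (-R) R := hK.intervalIntegrable
    have iA0 := (cA 0 hz0).intervalIntegrable (μ := volume) (-R) R
    have iB0 := (cB 0 hz0).intervalIntegrable (μ := volume) (-R) R
    have iA := (cA ζ hζ).intervalIntegrable (μ := volume) (-R) R
    have iB := (cB ζ hζ).intervalIntegrable (μ := volume) (-R) R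
    rw [intervalIntegral.integral_sub ((iK.const_mul _).sub ((iA0.sub iB0).const_mul _))
        ((iA.sub iB).const_mul _),
      intervalIntegral.integral_sub (iK.const_mul _) ((iA0.sub iB0).const_mul _),
      intervalIntegral.integral_const_mul, intervalIntegral.integral_const_mul,
      intervalIntegral.integral_const_mul, intervalIntegral.integral_sub iA0 iB0,
      intervalIntegral.integral_sub iA iB] at h
    simp only [one_mul, neg_one_mul]
    linear_combination h
  have l1 : Tendsto (fun R : ℝ => 2 * Real.pi * Complex.I * ∫ x in -R..R, stripKernel ζ x) atTop
      (𝓝 (2 * Real.pi * Complex.I * ∫ x, stripKernel ζ x)) :=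
    (intervalIntegral_tendsto_integral hK tendsto_neg_atTop_atBot tendsto_id).const_mul _
  have l2 := ((((tendsto_integral_inv_sub_horizontal 0 hz0).const_mul c).add
    ((tendsto_integral_inv_sub_horizontal ζ hζ).const_mul ζ⁻¹)).sub
    ((side 1 (by simp)).const_mul Complex.I)).add ((side (-1) (by simp)).const_mul Complex.I)
  have := tendsto_nhds_unique l1 (l2.congr fun R => (rect R).symm)
  have hI : 2 * (Real.pi : ℂ) * Complex.I ≠ 0 := Complex.two_pi_I_ne_zero
  apply mul_left_cancel₀ hI
  rw [this, one_div ζ]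
  ring

/-! ### The representation of `1 / Log (1 + z)` -/

theorem add_ofReal_mem_slitPlane {z : ℂ} (hz : 1 + z ∈ Complex.slitPlane) {t : ℝ} (ht : 1 ≤ t) :
    z + t ∈ Complex.slitPlane := by
  rw [Complex.mem_slitPlane_iff] at hz ⊢
  rcases hz with h | h
  · left
    simp only [Complex.add_re, Complex.one_re, Complex.ofReal_re] at h ⊢
    linarith
  · right
    simpa using h

/-- Compactness handles bounded `t`, and `|z + t| ≥ t/2` handles the rest. The bound reduces
integrability for complex `z` to that of positive real kernels. -/
theorem exists_norm_div_add_le {z : ℂ} (hz : 1 + z ∈ Complex.slitPlane) :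
    ∃ C : ℝ, ∀ t : ℝ, 1 ≤ t → ‖(t : ℂ) / (z + t)‖ ≤ C := by
  have hcont : ContinuousOn (fun t : ℝ => (t : ℂ) / (z + t)) (Icc 1 (2 * ‖z‖ + 1)) := by
    refine ContinuousOn.div (by fun_prop) (by fun_prop) fun t ht => ?_
    exact Complex.slitPlane_ne_zero (add_ofReal_mem_slitPlane hz ht.1)
  obtain ⟨C, hC⟩ := isCompact_Icc.exists_bound_of_continuousOn hcont
  refine ⟨max C 2, fun t ht => ?_⟩
  rcases le_or_gt t (2 * ‖z‖ + 1) with h | h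
  · exact (hC t ⟨ht, h⟩).trans (le_max_left _ _)
  · refine le_trans ?_ (le_max_right _ _)
    have ht0 : 0 < t := by linarith
    have h1 : t / 2 ≤ ‖z + t‖ := by
      have := norm_sub_norm_le (t : ℂ) (-z)
      rw [sub_neg_eq_add, norm_neg, Complex.norm_of_nonneg ht0.le, add_comm (t : ℂ)] at this
      linarith
    rw [norm_div, Complex.norm_of_nonneg ht0.le, div_le_iff₀ (by linarith)]
    linarith

/-- The density `1 / (log² (t-1) + π²)` in the representation of `1 / Log (1 + z)`. -/
noncomputable def logDensity (t : ℝ) : ℝ := 1 / (Real.log (t - 1) ^ 2 + Real.pi ^ 2)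

theorem logDensity_pos (t : ℝ) : 0 < logDensity t := by
  have := Real.pi_pos
  unfold logDensity; positivity

theorem measurable_logDensity : Measurable logDensity := by
  unfold logDensity
  fun_prop

theorem integrable_inv_sq_add_pi_sq : Integrable fun x : ℝ => (x ^ 2 + Real.pi ^ 2)⁻¹ := by
  refine integrable_inv_one_add_sq.mono' (by fun_prop) (ae_of_all _ fun x => ?_)
  have h : 1 ≤ Real.pi ^ 2 := by nlinarith [Real.pi_gt_three]
  rw [Real.norm_of_nonneg (by positivity)]
  exact inv_anti₀ (by positivity) (by linarith)

theorem stripKernel_eq {w : ℂ} (hw : w ≠ 0) (x : ℝ) :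
    stripKernel (Complex.log w) x =
      ((Real.exp x : ℝ) : ℂ) / (w + (Real.exp x : ℝ)) * (((x ^ 2 + Real.pi ^ 2)⁻¹ : ℝ) : ℂ) := by
  have hx : Complex.exp x ≠ 0 := Complex.exp_ne_zero _
  rw [stripKernel, Complex.exp_sub, Complex.exp_log hw, one_div, mul_inv]
  push_cast
  rw [← inv_div]
  congr 1
  field_simp
  ring

theorem integrable_stripKernel_log {w : ℂ} (hw : w ∈ Complex.slitPlane) :
    Integrable (stripKernel (Complex.log w)) := by
  obtain ⟨C, hC⟩ := exists_norm_div_add_le (z := w - 1) (by simpa using hw)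
  have hw0 := Complex.slitPlane_ne_zero hw
  rw [funext (stripKernel_eq hw0)]
  refine Integrable.bdd_mul (c := C) integrable_inv_sq_add_pi_sq.ofReal
    (Measurable.div (by fun_prop) (by fun_prop)).aestronglyMeasurable (ae_of_all _ fun x => ?_)
  have hx := Real.exp_pos x
  refine le_trans ?_ (hC (1 + Real.exp x) (by linarith))
  have e : w - 1 + ((1 + Real.exp x : ℝ) : ℂ) = w + (Real.exp x : ℝ) := by push_cast; ring
  rw [e, norm_div, norm_div]
  gcongr ?_ / _
  rw [Complex.norm_of_nonneg hx.le, Complex.norm_of_nonneg (by linarith)]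
  linarith

theorem image_one_add_exp : (fun x : ℝ => 1 + Real.exp x) '' univ = Ioi 1 := by
  ext t
  simp only [image_univ, mem_range, mem_Ioi]
  constructor
  · rintro ⟨x, rfl⟩
    have := Real.exp_pos x
    linarith
  · intro h
    exact ⟨Real.log (t - 1), by rw [Real.exp_log (by linarith)]; ring⟩

theorem logDensity_subst {z : ℂ} (hz : 1 + z ∈ Complex.slitPlane) (x : ℝ) :
    |Real.exp x| • ((logDensity (1 + Real.exp x) : ℂ) / (z + ((1 + Real.exp x : ℝ) : ℂ))) =
      stripKernel (Complex.log (1 + z)) x := by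
  rw [stripKernel_eq (Complex.slitPlane_ne_zero hz), abs_of_pos (Real.exp_pos x), logDensity,
    add_sub_cancel_left, Real.log_exp, Complex.real_smul, one_div,
    show z + ((1 + Real.exp x : ℝ) : ℂ) = 1 + z + (Real.exp x : ℝ) by push_cast; ring]
  ring

theorem integrableOn_logDensity_div {z : ℂ} (hz : 1 + z ∈ Complex.slitPlane) :
    IntegrableOn (fun t : ℝ => (logDensity t : ℂ) / (z + t)) (Ioi 1) := by
  rw [← image_one_add_exp, integrableOn_image_iff_integrableOn_abs_deriv_smul
    (f' := Real.exp) MeasurableSet.univ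
    (fun x _ => ((Real.hasDerivAt_exp x).const_add 1).hasDerivWithinAt)
    (fun a _ b _ h => Real.exp_injective (by simpa using h))]
  simp only [logDensity_subst hz, integrableOn_univ]
  exact integrable_stripKernel_log hz

theorem one_div_clog_one_add {z : ℂ} (hz : 1 + z ∈ Complex.slitPlane) (h0 : z ≠ 0) :
    1 / Complex.log (1 + z) = 1 / z + ∫ t in Ioi (1 : ℝ), (logDensity t : ℂ) / (z + t) := by
  have hw0 := Complex.slitPlane_ne_zero hz
  have hl0 : Complex.log (1 + z) ≠ 0 := by
    intro h
    have := Complex.exp_log hw0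
    rw [h, Complex.exp_zero] at this
    exact h0 (by linear_combination -this)
  have him : |(Complex.log (1 + z)).im| < Real.pi := by
    rw [Complex.log_im]
    exact abs_lt.2 ⟨Complex.neg_pi_lt_arg _,
      lt_of_le_of_ne (Complex.arg_le_pi _) (Complex.mem_slitPlane_iff_arg.1 hz).1⟩
  have := integral_stripKernel him hl0 (integrable_stripKernel_log hz)
  rw [← image_one_add_exp, integral_image_eq_integral_abs_deriv_smul
    (f' := Real.exp) MeasurableSet.univ
    (fun x _ => ((Real.hasDerivAt_exp x).const_add 1).hasDerivWithinAt)
    (fun a _ b _ h => Real.exp_injective (by simpa using h))]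
  simp only [logDensity_subst hz, setIntegral_univ]
  rw [this, Complex.exp_log hw0, show 1 - (1 + z) = -z by ring, div_neg]
  ring

/-! ### Partial fractions in `z` for fixed `s` -/

/-- `-1 / (s log (1 - 1/s))`. -/
noncomputable def poleWeight (s : ℝ) : ℝ := -1 / (s * Real.log (1 - s⁻¹))

theorem measurable_poleWeight : Measurable poleWeight := by
  unfold poleWeight
  fun_prop

/-- This is the formula for `1 / Log (1 + z)` at `z = -1/s`; `poleWeight s` is the value of `z / Log
(1 + z)` there. -/
theorem integral_logDensity_div_mul_sub_one {s : ℝ} (hs : 1 < s) :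
    IntegrableOn (fun t : ℝ => logDensity t / (s * t - 1)) (Ioi 1) ∧
      ∫ t in Ioi (1 : ℝ), logDensity t / (s * t - 1) = 1 - poleWeight s := by
  have hs0 : 0 < s := by linarith
  have hinv : s⁻¹ < 1 := inv_lt_one_of_one_lt₀ hs
  have hinv0 : 0 < s⁻¹ := inv_pos.2 hs0
  have hw : (1 : ℂ) + ((-s⁻¹ : ℝ) : ℂ) = ((1 - s⁻¹ : ℝ) : ℂ) := by push_cast; ring
  have hz : (1 : ℂ) + ((-s⁻¹ : ℝ) : ℂ) ∈ Complex.slitPlane := by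
    rw [hw]
    exact Complex.ofReal_mem_slitPlane.2 (by linarith)
  have hz0 : ((-s⁻¹ : ℝ) : ℂ) ≠ 0 := by
    have : -s⁻¹ ≠ 0 := by linarith
    exact_mod_cast this
  have e : ∀ t : ℝ, (logDensity t : ℂ) / (((-s⁻¹ : ℝ) : ℂ) + t) =
      ((s * (logDensity t / (s * t - 1)) : ℝ) : ℂ) := by
    intro t
    rw [← Complex.ofReal_add, ← Complex.ofReal_div]
    congr 1
    have : -s⁻¹ + t = (s * t - 1) / s := by field_simp; ring
    rw [this, div_div_eq_mul_div]
    ring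
  have h1 := integrableOn_logDensity_div hz
  have h2 := one_div_clog_one_add hz hz0
  simp only [e] at h1 h2
  have h1' : IntegrableOn (fun t : ℝ => s * (logDensity t / (s * t - 1))) (Ioi 1) := h1.re
  refine ⟨(h1'.const_mul s⁻¹).congr (ae_of_all _ fun t => by field_simp), ?_⟩
  have hlog : Real.log (1 - s⁻¹) ≠ 0 :=
    (Real.log_neg (by linarith) (by linarith)).ne
  rw [hw, ← Complex.ofReal_log (by linarith), integral_complex_ofReal, integral_const_mul] at h2
  have h3 : 1 / Real.log (1 - s⁻¹) = 1 / (-s⁻¹) +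
      s * ∫ t in Ioi (1 : ℝ), logDensity t / (s * t - 1) := by exact_mod_cast h2
  rw [poleWeight]
  generalize (∫ t in Ioi (1 : ℝ), logDensity t / (s * t - 1)) = X at *
  have h4 : 1 / (-s⁻¹) = -s := by rw [div_neg, one_div, inv_inv]
  rw [h4] at h3
  field_simp at h3 ⊢
  linarith

theorem poleWeight_nonneg {s : ℝ} (hs : 1 < s) : 0 ≤ poleWeight s := by
  have hinv : s⁻¹ < 1 := inv_lt_one_of_one_lt₀ hs
  have hinv0 : 0 < s⁻¹ := inv_pos.2 (by linarith)
  have := Real.log_neg (show 0 < 1 - s⁻¹ by linarith) (by linarith)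
  exact div_nonneg_of_nonpos (by norm_num) (mul_nonpos_of_nonneg_of_nonpos (by linarith) this.le)

theorem poleWeight_le_one {s : ℝ} (hs : 1 < s) : poleWeight s ≤ 1 := by
  have h := (integral_logDensity_div_mul_sub_one hs).2
  have : 0 ≤ ∫ t in Ioi (1 : ℝ), logDensity t / (s * t - 1) := by
    refine setIntegral_nonneg measurableSet_Ioi fun t ht => ?_
    have ht : 1 < t := ht
    exact div_nonneg (logDensity_pos t).le (by nlinarith)
  linarith

theorem partial_fraction_clog {z : ℂ} (hz : 1 + z ∈ Complex.slitPlane) {s : ℝ} (hs : 1 < s)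
    (hsz : 1 + s * z ≠ 0) :
    (1 + z * ∫ t in Ioi (1 : ℝ), (logDensity t : ℂ) / (z + t)) / (1 + s * z) =
      poleWeight s / (1 + s * z) +
      ∫ t in Ioi (1 : ℝ), ((logDensity t / (s * t - 1) : ℝ) : ℂ) * (t / (z + t)) := by
  obtain ⟨hi, hv⟩ := integral_logDensity_div_mul_sub_one hs
  have hb := integrableOn_logDensity_div hz
  have hi' : IntegrableOn (fun t : ℝ => ((logDensity t / (s * t - 1) : ℝ) : ℂ)) (Ioi 1) :=
    hi.ofReal
  -- This rests on `t (1 + sz) = z (st - 1) + (z + t)`. The integral of the last term, `1 -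
  -- poleWeight s`, produces the pole term.
  have e : ∀ t ∈ Ioi (1 : ℝ), ((logDensity t / (s * t - 1) : ℝ) : ℂ) * (t / (z + t)) =
      (1 + s * z)⁻¹ * (z * ((logDensity t : ℂ) / (z + t)) +
        ((logDensity t / (s * t - 1) : ℝ) : ℂ)) := by
    intro t ht
    have ht : 1 < t := ht
    have n1 : z + t ≠ 0 := Complex.slitPlane_ne_zero (add_ofReal_mem_slitPlane hz ht.le)
    have n2' : s * t - 1 ≠ 0 := by nlinarith
    have n2 : (s : ℂ) * t - 1 ≠ 0 := by exact_mod_cast n2'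
    push_cast
    field_simp
    ring
  rw [setIntegral_congr_fun measurableSet_Ioi e, integral_const_mul,
    integral_add (hb.const_mul z) hi', integral_const_mul, integral_complex_ofReal, hv]
  push_cast
  field_simp
  ring

/-! ### Fubini and the density on `t > 1` -/

theorem integrableOn_poleWeight (r : ℝ) : IntegrableOn poleWeight (Ioc 1 r) := by
  refine Measure.integrableOn_of_bounded (M := 1) (by simp)
    measurable_poleWeight.aestronglyMeasurable ?_
  filter_upwards [ae_restrict_mem measurableSet_Ioc] with s hs
  rw [Real.norm_of_nonneg (poleWeight_nonneg hs.1)]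
  exact poleWeight_le_one hs.1

/-- The kernel is singular at `s = t = 1`, but it is positive and its `t`-integral is exactly `1 -
poleWeight s`, which is bounded, so Tonelli applies. -/
theorem integrable_logDensity_prod (r : ℝ) :
    Integrable (fun p : ℝ × ℝ => logDensity p.2 / (p.1 * p.2 - 1))
      ((volume.restrict (Ioc 1 r)).prod (volume.restrict (Ioi 1))) := by
  have hm : Measurable fun p : ℝ × ℝ => logDensity p.2 / (p.1 * p.2 - 1) :=
    (measurable_logDensity.comp measurable_snd).div (by fun_prop)
  rw [integrable_prod_iff hm.aestronglyMeasurable]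
  constructor
  · filter_upwards [ae_restrict_mem measurableSet_Ioc] with s hs
    exact (integral_logDensity_div_mul_sub_one hs.1).1
  · have h1 : IntegrableOn (fun s => 1 - poleWeight s) (Ioc 1 r) :=
      (integrableOn_const (by simp)).sub (integrableOn_poleWeight r)
    refine h1.congr ?_
    filter_upwards [ae_restrict_mem measurableSet_Ioc] with s hs
    rw [← (integral_logDensity_div_mul_sub_one hs.1).2]
    refine setIntegral_congr_fun measurableSet_Ioi fun t ht => ?_
    have ht : 1 < t := ht
    exact (Real.norm_of_nonneg (div_nonneg (logDensity_pos t).le (by nlinarith [hs.1]))).symm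

theorem integrable_logDensity_prod_mul {z : ℂ} (hz : 1 + z ∈ Complex.slitPlane) (r : ℝ) :
    Integrable (fun p : ℝ × ℝ =>
        ((logDensity p.2 / (p.1 * p.2 - 1) : ℝ) : ℂ) * ((p.2 : ℂ) / (z + p.2)))
      ((volume.restrict (Ioc 1 r)).prod (volume.restrict (Ioi 1))) := by
  obtain ⟨C, hC⟩ := exists_norm_div_add_le hz
  have h := (integrable_logDensity_prod r).ofReal (𝕜 := ℂ)
  have hm : Measurable fun p : ℝ × ℝ => (p.2 : ℂ) / (z + p.2) :=
    Measurable.div (by fun_prop) (by fun_prop)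
  refine (h.bdd_mul (c := C) hm.aestronglyMeasurable ?_).congr (ae_of_all _ fun p => mul_comm _ _)
  rw [Measure.prod_restrict]
  filter_upwards [ae_restrict_mem (measurableSet_Ioc.prod measurableSet_Ioi)] with p hp
  exact hC _ (le_of_lt hp.2)

theorem omegaDensity_of_one_lt {r t : ℝ} (ht : 1 < t) :
    omegaDensity r t = Real.log ((r * t - 1) / (t - 1)) * logDensity t := by
  rw [omegaDensity, if_neg ht.not_gt, if_neg ht.ne', logDensity, mul_one_div]

theorem integral_inv_mul_sub_one {r t : ℝ} (hr : 1 < r) (ht : 1 < t) :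
    ∫ s in Ioc 1 r, (s * t - 1)⁻¹ = Real.log ((r * t - 1) / (t - 1)) / t := by
  rw [← intervalIntegral.integral_of_le hr.le]
  have hpos : ∀ s ∈ uIcc 1 r, 0 < s * t - 1 := by
    intro s hs
    rw [uIcc_of_le hr.le] at hs
    nlinarith [hs.1]
  rw [intervalIntegral.integral_eq_sub_of_hasDerivAt (f := fun s => Real.log (s * t - 1) / t)]
  · rw [Real.log_div (by nlinarith) (by linarith), one_mul]
    ring
  · intro s hs
    have h := ((((hasDerivAt_id s).mul_const t).sub_const 1).log (hpos s hs).ne').div_const t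
    refine h.congr_deriv ?_
    simp only [id]
    field_simp
  · refine ContinuousOn.intervalIntegrable ?_
    exact ContinuousOn.inv₀ (by fun_prop) fun s hs => (hpos s hs).ne'

theorem integral_prod_kernel {r : ℝ} (hr : 1 < r) {t : ℝ} (ht : 1 < t) (z : ℂ) :
    ∫ s in Ioc 1 r, ((logDensity t / (s * t - 1) : ℝ) : ℂ) * ((t : ℂ) / (z + t)) =
      (omegaDensity r t : ℂ) / (z + t) := by
  have ht0 : (t : ℂ) ≠ 0 := by
    have : t ≠ 0 := by linarith
    exact_mod_cast this
  rw [integral_mul_const, integral_complex_ofReal]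
  simp only [div_eq_mul_inv (logDensity t)]
  rw [integral_const_mul, integral_inv_mul_sub_one hr ht, omegaDensity_of_one_lt ht]
  push_cast
  field_simp

theorem integrableOn_omegaDensity_Ioi_one {r : ℝ} (hr : 1 < r) {z : ℂ}
    (hz : 1 + z ∈ Complex.slitPlane) :
    IntegrableOn (fun t : ℝ => (omegaDensity r t : ℂ) / (z + t)) (Ioi 1) := by
  refine (integrable_logDensity_prod_mul hz r).integral_prod_right.congr ?_
  filter_upwards [ae_restrict_mem measurableSet_Ioi] with t ht
  exact integral_prod_kernel hr ht z

theorem integral_omegaDensity_Ioi_one {r : ℝ} (hr : 1 < r) {z : ℂ}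
    (hz : 1 + z ∈ Complex.slitPlane) :
    ∫ t in Ioi (1 : ℝ), (omegaDensity r t : ℂ) / (z + t) =
      ∫ s in Ioc 1 r, ∫ t in Ioi (1 : ℝ),
        ((logDensity t / (s * t - 1) : ℝ) : ℂ) * ((t : ℂ) / (z + t)) := by
  rw [integral_integral_swap (integrable_logDensity_prod_mul hz r)]
  exact (setIntegral_congr_fun measurableSet_Ioi fun t ht => integral_prod_kernel hr ht z).symm

/-! ### The density on `(1/r, 1)` via `t = 1/s` -/

theorem image_inv_Ioo_one {r : ℝ} (hr : 1 < r) :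
    (fun s : ℝ => s⁻¹) '' Ioo 1 r = Ioo (1 / r) 1 := by
  rw [image_inv_eq_inv]
  ext t
  simp only [Set.mem_inv, mem_Ioo, one_div]
  constructor
  · rintro ⟨h1, h2⟩
    have ht : 0 < t := inv_pos.1 (by linarith)
    exact ⟨inv_lt_of_inv_lt₀ ht h2, (one_lt_inv₀ ht).1 h1⟩
  · rintro ⟨h1, h2⟩
    have ht : 0 < t := (inv_pos.2 (by linarith)).trans h1
    exact ⟨(one_lt_inv₀ ht).2 h2, inv_lt_of_inv_lt₀ (by linarith) h1⟩

theorem omegaDensity_subst_inv {r s : ℝ} (hs : 1 < s) (z : ℂ) :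
    |-(s ^ 2)⁻¹| • ((omegaDensity r s⁻¹ : ℂ) / (z + ((s⁻¹ : ℝ) : ℂ))) =
      (poleWeight s : ℂ) / (1 + s * z) := by
  have hs0 : s ≠ 0 := by linarith
  have hs0' : (s : ℂ) ≠ 0 := by exact_mod_cast hs0
  rw [omegaDensity, if_pos (inv_lt_one_of_one_lt₀ hs), poleWeight, abs_neg,
    abs_of_nonneg (by positivity), Complex.real_smul]
  have : z + ((s⁻¹ : ℝ) : ℂ) = (1 + s * z) / s := by
    push_cast; field_simp; ring
  rw [this]
  push_cast
  simp only [div_eq_mul_inv, mul_inv, inv_inv]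
  field_simp

/-- For real `z`, `1 + sz` lies between two positive numbers; otherwise its imaginary part `s Im z`
is nonzero. -/
theorem one_add_mul_mem_slitPlane {r : ℝ} {z : ℂ} (hz : 1 + z ∈ Complex.slitPlane)
    (hrz : 1 + r * z ∈ Complex.slitPlane) {s : ℝ} (hs : s ∈ Icc 1 r) :
    1 + s * z ∈ Complex.slitPlane := by
  simp only [Complex.mem_slitPlane_iff, Complex.add_re, Complex.one_re, Complex.re_ofReal_mul,
    Complex.add_im, Complex.one_im, zero_add, Complex.im_ofReal_mul] at *
  obtain ⟨h1, h2⟩ := hs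
  by_cases him : z.im = 0
  · left
    have hz' : 0 < 1 + z.re := hz.resolve_right fun h => h him
    have hrz' : 0 < 1 + r * z.re := hrz.resolve_right fun h => h (by rw [him, mul_zero])
    rcases le_or_gt 0 z.re with h | h <;> nlinarith
  · right
    exact mul_ne_zero (by linarith) him

theorem integrableOn_poleWeight_div {r : ℝ} {z : ℂ} (hz : 1 + z ∈ Complex.slitPlane)
    (hrz : 1 + r * z ∈ Complex.slitPlane) :
    IntegrableOn (fun s : ℝ => (poleWeight s : ℂ) / (1 + s * z)) (Ioc 1 r) := by
  have hc : ContinuousOn (fun s : ℝ => (1 + s * z)⁻¹) (Icc 1 r) :=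
    ContinuousOn.inv₀ (by fun_prop) fun s hs =>
      Complex.slitPlane_ne_zero (one_add_mul_mem_slitPlane hz hrz hs)
  have hi : IntegrableOn (fun s : ℝ => (1 + s * z)⁻¹) (Ioc 1 r) :=
    (hc.integrableOn_compact isCompact_Icc).mono_set Ioc_subset_Icc_self
  refine Integrable.bdd_mul (c := 1) hi
    (Complex.measurable_ofReal.comp measurable_poleWeight).aestronglyMeasurable ?_
  filter_upwards [ae_restrict_mem measurableSet_Ioc] with s hs
  change ‖(poleWeight s : ℂ)‖ ≤ 1
  rw [Complex.norm_of_nonneg (poleWeight_nonneg hs.1)]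
  exact poleWeight_le_one hs.1

theorem integrableOn_omegaDensity_Ioc {r : ℝ} (hr : 1 < r) {z : ℂ}
    (hz : 1 + z ∈ Complex.slitPlane) (hrz : 1 + r * z ∈ Complex.slitPlane) :
    IntegrableOn (fun t : ℝ => (omegaDensity r t : ℂ) / (z + t)) (Ioc (1 / r) 1) ∧
      ∫ t in Ioc (1 / r) 1, (omegaDensity r t : ℂ) / (z + t) =
        ∫ s in Ioc 1 r, (poleWeight s : ℂ) / (1 + s * z) := by
  have hd : ∀ s ∈ Ioo 1 r, HasDerivWithinAt (fun s : ℝ => s⁻¹) (-(s ^ 2)⁻¹) (Ioo 1 r) s :=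
    fun s hs => (hasDerivAt_inv (by linarith [hs.1])).hasDerivWithinAt
  have hinj : InjOn (fun s : ℝ => s⁻¹) (Ioo 1 r) := inv_injective.injOn
  have hsub : ∀ s ∈ Ioo 1 r, |-(s ^ 2)⁻¹| • ((omegaDensity r s⁻¹ : ℂ) / (z + ((s⁻¹ : ℝ) : ℂ))) =
      (poleWeight s : ℂ) / (1 + s * z) := fun s hs => omegaDensity_subst_inv hs.1 z
  constructor
  · rw [integrableOn_Ioc_iff_integrableOn_Ioo, ← image_inv_Ioo_one hr,
      integrableOn_image_iff_integrableOn_abs_deriv_smul measurableSet_Ioo hd hinj,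
      integrableOn_congr_fun hsub measurableSet_Ioo, ← integrableOn_Ioc_iff_integrableOn_Ioo]
    exact integrableOn_poleWeight_div hz hrz
  · rw [integral_Ioc_eq_integral_Ioo, ← image_inv_Ioo_one hr,
      integral_image_eq_integral_abs_deriv_smul measurableSet_Ioo hd hinj,
      setIntegral_congr_fun measurableSet_Ioo hsub, ← integral_Ioc_eq_integral_Ioo]

/-! ### Assembling the representation of `f_r` -/

theorem clog_sub_clog_eq_integral {r : ℝ} (hr : 1 < r) {z : ℂ}
    (hz : 1 + z ∈ Complex.slitPlane) (hrz : 1 + r * z ∈ Complex.slitPlane) :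
    ∫ s in Ioc 1 r, z / (1 + s * z) = Complex.log (1 + r * z) - Complex.log (1 + z) := by
  rw [← intervalIntegral.integral_of_le hr.le]
  have hm : ∀ s ∈ uIcc 1 r, 1 + s * z ∈ Complex.slitPlane := by
    intro s hs
    rw [uIcc_of_le hr.le] at hs
    exact one_add_mul_mem_slitPlane hz hrz hs
  rw [intervalIntegral.integral_eq_sub_of_hasDerivAt
    (f := fun s : ℝ => Complex.log (1 + s * z))]
  · simp
  · intro s hs
    refine HasDerivAt.clog_real ?_ (hm s hs)
    have h := ((HasDerivAt.ofReal_comp (hasDerivAt_id s)).mul_const z).const_add 1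
    exact h.congr_deriv (by simp)
  · refine ContinuousOn.intervalIntegrable ?_
    exact ContinuousOn.div (by fun_prop) (by fun_prop)
      fun s hs => Complex.slitPlane_ne_zero (hm s hs)

theorem fComplex_eq_integral_Ioc {r : ℝ} (hr : 1 < r) {z : ℂ}
    (hz : 1 + z ∈ Complex.slitPlane) (hrz : 1 + r * z ∈ Complex.slitPlane) :
    fComplex r z = 1 + ∫ s in Ioc 1 r,
      (1 + z * ∫ t in Ioi (1 : ℝ), (logDensity t : ℂ) / (z + t)) / (1 + s * z) := by
  by_cases h0 : z = 0
  -- At `z = 0` the integrand is `1` on an interval of length `r - 1`, matching the assigned value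
  -- `r`.
  · subst h0
    simp only [fComplex, if_true, zero_mul, mul_zero, add_zero, div_one]
    simp [hr.le]
  · have hl0 : Complex.log (1 + z) ≠ 0 := by
      intro h
      have := Complex.exp_log (Complex.slitPlane_ne_zero hz)
      rw [h, Complex.exp_zero] at this
      exact h0 (by linear_combination -this)
    have hk : 1 + z * ∫ t in Ioi (1 : ℝ), (logDensity t : ℂ) / (z + t) =
        z / Complex.log (1 + z) := by
      rw [div_eq_mul_one_div z, one_div_clog_one_add hz h0]
      field_simp
    have e : ∀ s : ℝ, z / Complex.log (1 + z) / (1 + s * z) =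
        (Complex.log (1 + z))⁻¹ * (z / (1 + s * z)) := fun s => by ring
    rw [fComplex, if_neg h0, hk]
    simp only [e]
    rw [integral_const_mul, clog_sub_clog_eq_integral hr hz hrz]
    field_simp
    ring

/-- The integral representation of `f_r` off the cut. -/
theorem fComplex_eq_integral {r : ℝ} (hr : 1 < r) {z : ℂ}
    (hz : 1 + z ∈ Complex.slitPlane) (hrz : 1 + r * z ∈ Complex.slitPlane) :
    IntegrableOn (fun t : ℝ => (omegaDensity r t : ℂ) / (z + t)) (Ioi (1 / r)) ∧
      fComplex r z = 1 + ∫ t in Ioi (1 / r), (omegaDensity r t : ℂ) / (z + t) := by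
  have hr1 : 1 / r ≤ 1 := by rw [div_le_one (by linarith)]; exact hr.le
  obtain ⟨i1, v1⟩ := integrableOn_omegaDensity_Ioc hr hz hrz
  have i2 := integrableOn_omegaDensity_Ioi_one hr hz
  rw [← Ioc_union_Ioi_eq_Ioi hr1]
  refine ⟨i1.union i2, ?_⟩
  rw [setIntegral_union (Set.Ioc_disjoint_Ioi le_rfl) measurableSet_Ioi i1 i2, v1,
    integral_omegaDensity_Ioi_one hr hz, fComplex_eq_integral_Ioc hr hz hrz,
    ← integral_add (integrableOn_poleWeight_div hz hrz)
      (integrable_logDensity_prod_mul hz r).integral_prod_left]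
  congr 1
  refine setIntegral_congr_fun measurableSet_Ioc fun s hs => ?_
  exact partial_fraction_clog hz hs.1
    (Complex.slitPlane_ne_zero (one_add_mul_mem_slitPlane hz hrz ⟨hs.1.le, hs.2⟩))

/-! ### Consequences on the real axis -/

theorem omegaDensity_pos {r t : ℝ} (hr : 1 < r) (ht : 1 / r ≤ t) (h1 : t ≠ 1) :
    0 < omegaDensity r t := by
  have hr0 : 0 < r := by linarith
  have ht0 : 0 < t := (by positivity : 0 < 1 / r).trans_le ht
  rcases lt_or_gt_of_ne h1 with h | h
  · rw [omegaDensity, if_pos h]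
    exact div_pos_of_neg_of_neg (by norm_num) (Real.log_neg (by linarith) (by linarith))
  · rw [omegaDensity_of_one_lt h]
    refine mul_pos (Real.log_pos ?_) (logDensity_pos t)
    rw [lt_div_iff₀ (by linarith)]
    nlinarith

theorem omegaDensity_nonneg {r t : ℝ} (hr : 1 < r) (ht : 1 / r ≤ t) : 0 ≤ omegaDensity r t := by
  rcases eq_or_ne t 1 with rfl | h
  · simp [omegaDensity]
  · exact (omegaDensity_pos hr ht h).le

theorem measurable_omegaDensity (r : ℝ) : Measurable (omegaDensity r) := by
  unfold omegaDensity
  refine Measurable.ite measurableSet_Iio (by fun_prop) (Measurable.ite (by simp) (by fun_prop) ?_)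
  exact Measurable.div (Real.measurable_log.comp (Measurable.div (by fun_prop) (by fun_prop)))
    (by fun_prop)

theorem mul_add_one_pos {r x : ℝ} (hr : 1 < r) (hx : -1 / r < x) : 0 < 1 + r * x ∧ 0 < 1 + x := by
  have hr0 : 0 < r := by linarith
  have h1 : 0 < 1 + r * x := by
    rw [div_lt_iff₀ hr0] at hx
    linarith
  refine ⟨h1, ?_⟩
  rcases le_or_gt 0 x with h | h <;> nlinarith

theorem fComplex_ofReal {r x : ℝ} (hr : 1 < r) (hx : -1 / r < x) :
    fComplex r x = (fReal r x : ℂ) := by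
  obtain ⟨h1, h2⟩ := mul_add_one_pos hr hx
  rcases eq_or_ne x 0 with rfl | h
  · simp [fComplex, fReal]
  · rw [fComplex, fReal, if_neg h, if_neg (by exact_mod_cast h), Complex.ofReal_div,
      Complex.ofReal_log h1.le, Complex.ofReal_log h2.le]
    push_cast
    rfl

theorem fReal_eq_integral {r x : ℝ} (hr : 1 < r) (hx : -1 / r < x) :
    IntegrableOn (fun t : ℝ => omegaDensity r t / (x + t)) (Ioi (1 / r)) ∧
      fReal r x = 1 + ∫ t in Ioi (1 / r), omegaDensity r t / (x + t) := by
  obtain ⟨h1, h2⟩ := mul_add_one_pos hr hx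
  have m1 : (1 : ℂ) + x ∈ Complex.slitPlane := by
    rw [← Complex.ofReal_one, ← Complex.ofReal_add]
    exact Complex.ofReal_mem_slitPlane.2 h2
  have m2 : (1 : ℂ) + r * x ∈ Complex.slitPlane := by
    rw [← Complex.ofReal_one, ← Complex.ofReal_mul, ← Complex.ofReal_add]
    exact Complex.ofReal_mem_slitPlane.2 h1
  obtain ⟨hi, hv⟩ := fComplex_eq_integral hr m1 m2
  simp only [← Complex.ofReal_add, ← Complex.ofReal_div] at hi hv
  refine ⟨hi.re, ?_⟩
  rw [fComplex_ofReal hr hx, integral_complex_ofReal] at hv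
  exact_mod_cast hv

theorem neg_one_div_neg {r : ℝ} (hr : 1 < r) : -1 / r < 0 :=
  div_neg_of_neg_of_pos (by norm_num) (by linarith)

theorem isStieltjes_fReal {r : ℝ} (hr : 1 < r) : IsStieltjes (fReal r) := by
  have hr0 : 0 < 1 / r := one_div_pos.2 (by linarith)
  have hrep : ∀ x : ℝ, 0 < x → _ := fun x hx =>
    fReal_eq_integral hr (x := x) ((neg_one_div_neg hr).trans hx)
  refine ⟨fun x hx => ?_, 1, zero_le_one,
    (volume.restrict (Ioi (1 / r))).withDensity fun t => ENNReal.ofReal (omegaDensity r t), ?_,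
    fun x hx => ?_⟩
  · rw [(hrep x hx).2]
    refine add_nonneg zero_le_one (setIntegral_nonneg measurableSet_Ioi fun t ht => ?_)
    have ht : 1 / r < t := ht
    exact div_nonneg (omegaDensity_nonneg hr ht.le) (by linarith)
  · refine withDensity_absolutelyContinuous _ _ ?_
    rw [Measure.restrict_apply measurableSet_Iio]
    refine measure_mono_null (fun t ht => ?_) measure_empty
    have h1 : t < 0 := ht.1
    have h2 : 1 / r < t := ht.2
    linarith
  · have hm : Measurable fun t => ENNReal.ofReal (omegaDensity r t) :=
      (measurable_omegaDensity r).ennreal_ofReal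
    have hfin : ∀ᵐ t ∂(volume.restrict (Ioi (1 / r))), ENNReal.ofReal (omegaDensity r t) < ⊤ :=
      ae_of_all _ fun t => ENNReal.ofReal_lt_top
    have he : EqOn (fun t => omegaDensity r t / (x + t))
        (fun t => (ENNReal.ofReal (omegaDensity r t)).toReal • (1 / (x + t))) (Ioi (1 / r)) := by
      intro t ht
      simp only
      rw [ENNReal.toReal_ofReal (omegaDensity_nonneg hr (le_of_lt ht)), smul_eq_mul, mul_one_div]
    obtain ⟨hi, hv⟩ := hrep x hx
    rw [integrable_withDensity_iff_integrable_smul' hm hfin,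
      integral_withDensity_eq_integral_toReal_smul hm hfin,
      ← setIntegral_congr_fun measurableSet_Ioi he]
    exact ⟨(integrableOn_congr_fun he measurableSet_Ioi).1 hi, hv⟩

/-- The density vanishes at `t = 1`, so pointwise strict inequalities hold only off that null point;
this still gives strict inequalities between integrals. -/
theorem setIntegral_Ioi_pos_of_pos_off_one {a : ℝ} {g : ℝ → ℝ} (hg : IntegrableOn g (Ioi a))
    (hpos : ∀ t, a < t → t ≠ 1 → 0 < g t) : 0 < ∫ t in Ioi a, g t := by
  rw [setIntegral_pos_iff_support_of_nonneg_ae ?_ hg]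
  · have hsub : Ioi (max a 1) ⊆ Function.support g ∩ Ioi a := fun t ht =>
      have h := max_lt_iff.1 (show max a 1 < t from ht)
      ⟨(hpos t h.1 h.2.ne').ne', h.1⟩
    refine lt_of_lt_of_le ?_ (measure_mono hsub)
    simp
  · filter_upwards [ae_restrict_mem measurableSet_Ioi,
      ae_restrict_of_ae (Measure.ae_ne volume (1 : ℝ))] with t ht h1
    exact (hpos t ht h1).le

theorem strictAntiOn_fReal {r : ℝ} (hr : 1 < r) : StrictAntiOn (fReal r) (Ioi (-1 / r)) := by
  intro x hx y hy hxy
  have hx : -1 / r < x := hx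
  obtain ⟨ix, vx⟩ := fReal_eq_integral hr hx
  obtain ⟨iy, vy⟩ := fReal_eq_integral hr (show -1 / r < y from hy)
  have h := setIntegral_Ioi_pos_of_pos_off_one (ix.sub iy) fun t ht h1 => by
    have hxt : 0 < x + t := by rw [neg_div] at hx; linarith
    exact sub_pos.2 (div_lt_div_of_pos_left (omegaDensity_pos hr ht.le h1) hxt (by linarith))
  simp only [Pi.sub_apply] at h
  rw [integral_sub ix iy] at h
  rw [vx, vy]
  linarith

theorem strictConvexOn_fReal {r : ℝ} (hr : 1 < r) :
    StrictConvexOn ℝ (Ioi (-1 / r)) (fReal r) := by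
  refine ⟨convex_Ioi _, fun x hx y hy hxy a b ha hb hab => ?_⟩
  have hz : -1 / r < a * x + b * y := (convex_Ioi (-1 / r)) hx hy ha.le hb.le hab
  have hx : -1 / r < x := hx
  have hy : -1 / r < y := hy
  obtain ⟨ix, vx⟩ := fReal_eq_integral hr hx
  obtain ⟨iy, vy⟩ := fReal_eq_integral hr hy
  obtain ⟨iz, vz⟩ := fReal_eq_integral hr hz
  have hsum : IntegrableOn (fun t => a * (omegaDensity r t / (x + t)) +
      b * (omegaDensity r t / (y + t))) (Ioi (1 / r)) := (ix.const_mul a).add (iy.const_mul b)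
  have h := setIntegral_Ioi_pos_of_pos_off_one (hsum.sub iz) fun t ht h1 => by
    have hω := omegaDensity_pos hr ht.le h1
    rw [neg_div] at hx hy
    have hxt : 0 < x + t := by linarith
    have hyt : 0 < y + t := by linarith
    have hc := (strictConvexOn_zpow (m := -1) (by norm_num) (by norm_num)).2
      (mem_Ioi.2 hxt) (mem_Ioi.2 hyt) (by simpa using hxy) ha hb hab
    simp only [zpow_neg_one, smul_eq_mul] at hc
    rw [show a * (x + t) + b * (y + t) = a * x + b * y + t by linear_combination t * hab] at hc
    simp only [Pi.sub_apply, div_eq_mul_inv]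
    nlinarith [mul_lt_mul_of_pos_left hc hω]
  simp only [Pi.sub_apply] at h
  rw [integral_sub hsum iz,
    integral_add (ix.const_mul a) (iy.const_mul b), integral_const_mul, integral_const_mul] at h
  simp only [smul_eq_mul]
  rw [vx, vy, vz]
  linarith

theorem tendsto_fReal_nhdsGT {r : ℝ} (hr : 1 < r) :
    Tendsto (fReal r) (𝓝[>] (-1 / r)) atTop := by
  have hr0 : 0 < r := by linarith
  have hlt : -1 / r < 0 := neg_one_div_neg hr
  have hgt : 0 < 1 + -1 / r := by
    rw [neg_div, ← sub_eq_add_neg, sub_pos, div_lt_one hr0]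
    exact hr
  have h1 : Tendsto (fun x => Real.log (1 + r * x)) (𝓝[>] (-1 / r)) atBot := by
    refine Real.tendsto_log_nhdsGT_zero.comp (tendsto_nhdsWithin_iff.2 ⟨?_, ?_⟩)
    · have : ContinuousAt (fun x : ℝ => 1 + r * x) (-1 / r) := by fun_prop
      have h := this.tendsto.mono_left (nhdsWithin_le_nhds (s := Ioi (-1 / r)))
      rwa [mul_div_cancel₀ _ hr0.ne', add_neg_cancel] at h
    · filter_upwards [self_mem_nhdsWithin] with x hx
      exact (mul_add_one_pos hr hx).1
  have h2 : Tendsto (fun x => (Real.log (1 + x))⁻¹) (𝓝[>] (-1 / r))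
      (𝓝 (Real.log (1 + -1 / r))⁻¹) := by
    -- The denominator tends to `log (1 - 1/r) < 0`, which turns the `-∞` of the numerator into
    -- `+∞`.
    have hne : Real.log (1 + -1 / r) ≠ 0 := (Real.log_neg hgt (by linarith)).ne
    have : ContinuousAt (fun x : ℝ => (Real.log (1 + x))⁻¹) (-1 / r) :=
      ((continuousAt_const.add continuousAt_id).log hgt.ne').inv₀ hne
    exact this.tendsto.mono_left nhdsWithin_le_nhds
  have h3 := h1.atBot_mul_neg (inv_lt_zero.2 (Real.log_neg hgt (by linarith))) h2
  refine h3.congr' ?_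
  filter_upwards [nhdsWithin_le_nhds (Iio_mem_nhds hlt)] with x hx
  rw [fReal, if_neg (ne_of_lt hx), div_eq_mul_inv]

theorem tendsto_fReal_atTop {r : ℝ} (hr : 1 < r) : Tendsto (fReal r) atTop (𝓝 1) := by
  have hr0 : 0 < r := by linarith
  have hadd : Tendsto (fun x : ℝ => 1 + x) atTop atTop :=
    tendsto_atTop_add_const_left _ _ tendsto_id
  have h1 : Tendsto (fun x : ℝ => r - (r - 1) / (1 + x)) atTop (𝓝 (r - 0)) :=
    tendsto_const_nhds.sub (hadd.const_div_atTop _)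
  rw [sub_zero] at h1
  -- Since `(1 + rx) / (1 + x) = r - (r - 1) / (1 + x)`, the excess of `f_r` over `1` is a bounded
  -- logarithm over a divergent one.
  have h2 : Tendsto (fun x : ℝ => 1 + Real.log (r - (r - 1) / (1 + x)) / Real.log (1 + x)) atTop
      (𝓝 (1 + 0)) :=
    ((h1.log hr0.ne').div_atTop (Real.tendsto_log_atTop.comp hadd)).const_add 1
  rw [add_zero] at h2
  refine h2.congr' ?_
  filter_upwards [eventually_gt_atTop 0] with x hx
  have hl : 0 < Real.log (1 + x) := Real.log_pos (by linarith)
  have e : r - (r - 1) / (1 + x) = (1 + r * x) / (1 + x) := by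
    field_simp
    ring
  rw [fReal, if_neg hx.ne', e, Real.log_div (by positivity) (by positivity)]
  field_simp
  ring

theorem mem_slitPlane_of_notMem_cut {r : ℝ} (hr : 1 < r) {z : ℂ}
    (hz : z ∈ ((fun x : ℝ => (x : ℂ)) '' Iic (-1 / r))ᶜ) :
    1 + z ∈ Complex.slitPlane ∧ 1 + r * z ∈ Complex.slitPlane := by
  simp only [Complex.mem_slitPlane_iff, Complex.add_re, Complex.one_re, Complex.re_ofReal_mul,
    Complex.add_im, Complex.one_im, zero_add, Complex.im_ofReal_mul]
  by_cases him : z.im = 0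
  · have hre : -1 / r < z.re := by
      by_contra! h
      exact hz ⟨z.re, h, Complex.ext (by simp) (by simp [him])⟩
    obtain ⟨h1, h2⟩ := mul_add_one_pos hr hre
    exact ⟨Or.inl h2, Or.inl h1⟩
  · exact ⟨Or.inr him, Or.inr (mul_ne_zero (by linarith) him)⟩

theorem theorem3 (r : ℝ) (hr : 1 < r) :
    IsStieltjes (fReal r) ∧
    (∀ t : ℝ, 1 / r ≤ t → 0 ≤ omegaDensity r t) ∧
    (∀ z : ℂ, z ∈ ((fun x : ℝ => (x : ℂ)) '' Iic (-1 / r))ᶜ →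
      IntegrableOn (fun t : ℝ => (omegaDensity r t : ℂ) / (z + (t : ℂ))) (Ioi (1 / r)) volume ∧
      fComplex r z = 1 + ∫ t in Ioi (1 / r), (omegaDensity r t : ℂ) / (z + (t : ℂ))) ∧
    StrictConvexOn ℝ (Ioi (-1 / r)) (fReal r) ∧
    StrictAntiOn (fReal r) (Ioi (-1 / r)) ∧
    Tendsto (fReal r) (𝓝[>] (-1 / r)) atTop ∧
    Tendsto (fReal r) atTop (𝓝 1) ∧
    IntegrableOn (fun t : ℝ => omegaDensity r t / t) (Ioi (1 / r)) volume ∧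
    ∫ t in Ioi (1 / r), omegaDensity r t / t = r - 1 := by
  -- The representation at `x = 0`, where the value is `r`, contains the moment identity.
  obtain ⟨hi, hv⟩ := fReal_eq_integral hr (neg_one_div_neg hr)
  simp only [zero_add] at hi hv
  refine ⟨isStieltjes_fReal hr, fun t ht => omegaDensity_nonneg hr ht, fun z hz => ?_,
    strictConvexOn_fReal hr, strictAntiOn_fReal hr, tendsto_fReal_nhdsGT hr,
    tendsto_fReal_atTop hr, hi, ?_⟩
  · obtain ⟨h1, h2⟩ := mem_slitPlane_of_notMem_cut hr hz
    exact fComplex_eq_integral hr h1 h2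
  · rw [fReal, if_pos rfl] at hv
    linarith
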